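/- Let $K$ be a complete ultrametric field with non-trivial absolute value. An affinoid $K$-algebra is a quotient of a Tate algebra $K\{T_1,\dots,T_N\}$, the $K$-algebra of formal power series $\sum_{\underline i} a_{\underline i}T^{\underline i}$ over $K$ with $|a_{\underline i}|\to 0$. Let $R$ be an affinoid $K$-algebra and let $A$ be a twisted affinoid $R$-algebra, that is, an affinoid $K$-algebra $A$ with a $K$-algebra homomorphism $R\to A$ and an $R$-algebra endomorphism $\sigma$ of $A$. Let $M$ be a finite $A$-module, and let $D:A\to M$ be a twisted derivation, i.e. an $R$-linear map such that $$D(z_1z_2)=z_2D(z_1)+\sigma(z_1)D(z_2)\qquad\text{for all } z_1,z_2\in A.$$ Then $D$ is continuous, for any ultrametric Banach $K$-algebra norm on $A$ and any ultrametric Banach $A$-module norm on $M$. -/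

import Mathlib

/-- The Tate algebra `K{T₁, …, T_N}` over an ultrametric normed field `K`: the `K`-algebra of formal
power series in `N` variables whose coefficients tend to `0` (along the cofinite filter on
multi-indices, i.e. restricted power series of polyradius `(1, …, 1)`). -/
def tateAlgebra (K : Type*) [NormedField K] [IsUltrametricDist K] (N : ℕ) :
    Subalgebra K (MvPowerSeries (Fin N) K) where
  __ := MvPowerSeries.IsRestricted.subring (R := K) (fun _ : Fin N => (1 : ℝ))
  algebraMap_mem' a := MvPowerSeries.isRestricted_C (R := K) (fun _ : Fin N => (1 : ℝ)) a

theorem mem_tateAlgebra {K : Type*} [NormedField K] [IsUltrametricDist K] {N : ℕ}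
    {f : MvPowerSeries (Fin N) K} :
    f ∈ tateAlgebra K N ↔
      Filter.Tendsto (fun i : Fin N →₀ ℕ => ‖MvPowerSeries.coeff i f‖) Filter.cofinite
        (nhds 0) := by
  change MvPowerSeries.IsRestricted (fun _ : Fin N => (1 : ℝ)) f ↔ _
  simp [MvPowerSeries.IsRestricted, Finsupp.prod]

/-- A `K`-algebra is affinoid if it is a quotient of some Tate algebra `K{T₁, …, T_N}`. -/
def IsAffinoidAlgebra (K : Type*) [NormedField K] [IsUltrametricDist K]
    (A : Type*) [CommRing A] [Algebra K A] : Prop :=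
  ∃ (N : ℕ) (π : tateAlgebra K N →ₐ[K] A), Function.Surjective π

/-- An `R`-linear map `D : A → M` is a twisted derivation, with respect to the endomorphism `σ`
of the `R`-algebra `A`, if it satisfies the twisted Leibniz rule
`D (z₁ z₂) = z₂ D(z₁) + σ(z₁) D(z₂)`. -/
def IsTwistedDerivation {R A M : Type*} [CommRing R] [CommRing A] [Algebra R A]
    [AddCommGroup M] [Module R M] [Module A M] (σ : A →ₐ[R] A) (D : A →ₗ[R] M) : Prop :=
  ∀ z₁ z₂ : A, D (z₁ * z₂) = z₂ • D z₁ + σ z₁ • D z₂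

/-! The proof is a closed graph argument. Suppose `u k → x` and `D (u k) → y`. For a maximal ideal
`I` and `J = I ^ n`, the Leibniz rule sends `J · σ⁻¹(J)` into `J M`. Both `J · σ⁻¹(J)` and `J M`
have finite codimension over `K`, and by the open mapping theorem both are closed. Hence `A → M → M
/ J M` factors through a finite-dimensional Hausdorff space and is continuous, so `y - D x ∈ J M`.
By Krull's intersection theorem, the `I ^ n M` over all `I` and `n` meet in zero, so `y = D x`.

This needs affinoid algebras to be Noetherian with residue fields finite over `K`. Both facts follow
by induction on the number of variables from
`TateAlgebra.exists_finite_algHom_quotient_span_singleton`: a proper quotient of a Tate algebra by a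
nonzero `f` is finite over a Tate algebra in fewer variables. To prove it, scale `f` to norm one,
apply Noether normalization to its reduction over the residue field of `K`, and lift the resulting
finite map by successive approximation. Weierstrass preparation is avoided. -/

open Filter Topology

/-! ### Finite ring maps and Noether normalization of polynomial hypersurfaces -/

section FiniteRingHom

variable {R S : Type*} [CommRing R] [CommRing S] {f : R →+* S}

theorem RingHom.Finite.exists_fin (hf : f.Finite) :
    ∃ (m : ℕ) (e : Fin m → S), ∀ x, ∃ c : Fin m → R, ∑ l, f (c l) * e l = x := by
  algebraize [f]
  obtain ⟨m, e, he⟩ := Module.Finite.exists_fin (R := R) (M := S)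
  refine ⟨m, e, fun x => ?_⟩
  obtain ⟨c, hc⟩ := (Submodule.mem_span_range_iff_exists_fun R).1
    (he ▸ Submodule.mem_top : x ∈ Submodule.span R (Set.range e))
  simp only [Algebra.smul_def] at hc
  exact ⟨c, hc⟩

theorem RingHom.Finite.of_fin {m : ℕ} (e : Fin m → S)
    (he : ∀ x, ∃ c : Fin m → R, ∑ l, f (c l) * e l = x) : f.Finite := by
  algebraize [f]
  refine Module.Finite.of_surjective (Fintype.linearCombination R e) fun x => ?_
  obtain ⟨c, hc⟩ := he x
  refine ⟨c, ?_⟩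
  rw [Fintype.linearCombination_apply, ← hc]
  exact Finset.sum_congr rfl fun l _ => Algebra.smul_def _ _

theorem RingHom.Finite.isNoetherianRing [IsNoetherianRing R] (hf : f.Finite) :
    IsNoetherianRing S := by
  algebraize [f]
  exact IsNoetherianRing.of_finite R S

theorem RingHom.Finite.isField_of_injective (hf : f.Finite) (hinj : Function.Injective f)
    (hS : IsField S) : IsField R := by
  have := hS.isDomain
  have : IsDomain R := hinj.isDomain f
  algebraize [f]
  have : FaithfulSMul R S := (faithfulSMul_iff_algebraMap_injective _ _).2 hinj
  exact isField_of_isIntegral_of_isField hinj hS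

theorem AlgHom.Finite.module_finite {K : Type*} [CommRing K] [Algebra K R] [Algebra K S]
    [Module.Finite K R] {φ : R →ₐ[K] S} (hφ : φ.Finite) : Module.Finite K S := by
  rw [← RingHom.finite_algebraMap, ← φ.comp_algebraMap]
  exact RingHom.Finite.comp hφ (RingHom.finite_algebraMap.2 inferInstance)

end FiniteRingHom

theorem ringKrullDim_le_of_isIntegral_of_injective {R S : Type*} [CommRing R] [IsDomain R]
    [CommRing S] [Algebra R S] [Algebra.IsIntegral R S] [FaithfulSMul R S] :
    ringKrullDim R ≤ ringKrullDim S := by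
  refine iSup_le fun l => ?_
  obtain ⟨⟨P, hP, hl⟩⟩ := Ideal.nonempty_primesOver (S := S) (RelSeries.head l).asIdeal
  obtain ⟨L, hL, -⟩ := Ideal.exists_ltSeries_of_hasGoingUp l P
  rw [← hL]
  exact Order.LTSeries.length_le_krullDim L

/-- Noether normalization provides `s`. Injectivity and integrality make `s` at most the dimension
of the quotient, which is at most `n - 1` because `f` is not a zero divisor. -/
theorem MvPolynomial.exists_finite_algHom_quotient_span_singleton {k : Type*} [Field k] {n : ℕ}
    {f : MvPolynomial (Fin n) k} (hf : f ≠ 0) (h : Ideal.span {f} ≠ ⊤) :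
    ∃ s < n, ∃ g : MvPolynomial (Fin s) k →ₐ[k] MvPolynomial (Fin n) k ⧸ Ideal.span {f},
      g.Finite := by
  obtain ⟨s, -, g, hinj, hint⟩ := exists_integral_inj_algHom_of_quotient _ h
  refine ⟨s, ?_, g, ?_⟩
  · algebraize [g.toRingHom]
    have : FaithfulSMul (MvPolynomial (Fin s) k) (MvPolynomial (Fin n) k ⧸ Ideal.span {f}) :=
      (faithfulSMul_iff_algebraMap_injective _ _).2 hinj
    have h1 := ringKrullDim_le_of_isIntegral_of_injective (R := MvPolynomial (Fin s) k)
      (S := MvPolynomial (Fin n) k ⧸ Ideal.span {f})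
    have h2 := ringKrullDim_quotient_succ_le_of_nonZeroDivisor (mem_nonZeroDivisors_of_ne_zero hf)
    have h3 := (add_le_add_left h1 1).trans h2
    simp only [MvPolynomial.ringKrullDim_of_isNoetherianRing, ringKrullDim_eq_zero_of_field,
      zero_add, Nat.card_eq_fintype_card, Fintype.card_fin] at h3
    exact_mod_cast h3
  · have : g.toRingHom.comp MvPolynomial.C = (algebraMap k _) := g.comp_algebraMap
    exact RingHom.IsIntegral.to_finite hint
      (RingHom.FiniteType.of_comp_finiteType (f := MvPolynomial.C)
        (this ▸ RingHom.finiteType_algebraMap.mpr inferInstance))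

/-! ### Closed subspaces of finite codimension -/

/-- A submodule of finite codimension which is the image of a Banach space is closed. -/
theorem ContinuousLinearMap.isClosed_range_of_finite_quotient {K E F : Type*}
    [NontriviallyNormedField K] [CompleteSpace K] [NormedAddCommGroup E] [NormedSpace K E]
    [CompleteSpace E] [NormedAddCommGroup F] [NormedSpace K F] [CompleteSpace F] (u : E →L[K] F)
    [Module.Finite K (F ⧸ u.range)] : IsClosed (u.range : Set F) := by
  obtain ⟨V, hV⟩ := Submodule.exists_isCompl u.range
  have : Module.Finite K V :=
    Module.Finite.equiv (Submodule.quotientEquivOfIsCompl _ _ hV)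
  have : CompleteSpace V := FiniteDimensional.complete K V
  -- By the open mapping theorem `w` is a quotient map, and the preimage of the range of `u` under
  -- it is the closed set `E × {0}`.
  let w : E × V →L[K] F := u.coprod V.subtypeL
  have hw : Function.Surjective w := fun x => by
    have hx : x ∈ u.range ⊔ V := hV.sup_eq_top ▸ Submodule.mem_top
    obtain ⟨_, ⟨e, rfl⟩, v, hv, rfl⟩ := Submodule.mem_sup.1 hx
    exact ⟨(e, ⟨v, hv⟩), rfl⟩
  have hq : IsQuotientMap w := (w.isOpenMap hw).isQuotientMap w.continuous hw
  rw [← hq.isClosed_preimage]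
  have : w ⁻¹' (u.range : Set F) = Prod.snd ⁻¹' {0} := by
    ext ⟨e, v⟩
    constructor
    · rintro ⟨e', he'⟩
      have h1 : (v : F) ∈ u.range := ⟨e' - e, by
        rw [map_sub]; exact sub_eq_of_eq_add' he'⟩
      exact Subtype.ext (Submodule.disjoint_def.1 hV.disjoint _ h1 v.2)
    · rintro rfl
      exact ⟨e, by simp [w]⟩
  rw [this]
  exact isClosed_singleton.preimage continuous_snd

theorem LinearMap.continuous_of_isClosed_le_ker {K E F : Type*} [NontriviallyNormedField K]
    [CompleteSpace K] [NormedAddCommGroup E] [NormedSpace K E] [NormedAddCommGroup F]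
    [NormedSpace K F] (u : E →ₗ[K] F) (P : Submodule K E) (hP : IsClosed (P : Set E))
    [Module.Finite K (E ⧸ P)] (h : P ≤ u.ker) : Continuous u := by
  have : Continuous (P.liftQ u h) := LinearMap.continuous_of_finiteDimensional _
  exact this.comp P.mkQL.continuous

/-! ### Finite codimension of products and preimages of ideals -/

section Codim

variable {K A M : Type*} [Field K] [CommRing A] [Algebra K A] [AddCommGroup M] [Module K M]
  [Module A M] [IsScalarTower K A M]

theorem Module.finite_quotient_smul_top (J : Ideal A) [Module.Finite K (A ⧸ J)]
    [Module.Finite A M] : Module.Finite K (M ⧸ J • (⊤ : Submodule A M)) := by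
  have : IsScalarTower K (A ⧸ J) (M ⧸ J • (⊤ : Submodule A M)) := ⟨fun a b x => by
    obtain ⟨b, rfl⟩ := Ideal.Quotient.mk_surjective b
    obtain ⟨x, rfl⟩ := Submodule.mkQ_surjective _ x
    change (J • (⊤ : Submodule A M)).mkQ ((a • b) • x) = a • (J • ⊤ : Submodule A M).mkQ (b • x)
    rw [smul_assoc]
    rfl⟩
  have : Module.Finite (A ⧸ J) (M ⧸ J • (⊤ : Submodule A M)) :=
    Module.Finite.of_restrictScalars_finite A _ _
  exact Module.Finite.trans (A ⧸ J) _

/-- Exactness of `N / J N → M / J N → M / N → 0`, with both outer terms finite over `K`. -/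
theorem Submodule.finite_quotient_smul_of_fg {J : Ideal A} [Module.Finite K (A ⧸ J)]
    {N : Submodule A M} (hN : N.FG) [Module.Finite K (M ⧸ N)] :
    Module.Finite K (M ⧸ J • N) := by
  have : Module.Finite A N := Module.Finite.of_fg hN
  have := Module.finite_quotient_smul_top (K := K) (M := N) J
  have hle : J • (⊤ : Submodule A N) ≤ (J • N).comap N.subtype := by
    rw [← Submodule.map_le_iff_le_comap, Submodule.map_smul'', Submodule.map_top,
      Submodule.range_subtype]
  let f : (N ⧸ J • (⊤ : Submodule A N)) →ₗ[A] M ⧸ J • N := Submodule.mapQ _ _ N.subtype hle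
  let g : (M ⧸ J • N) →ₗ[A] M ⧸ N := Submodule.factor Submodule.smul_le_right
  have hfg : Function.Exact f g := fun x => by
    obtain ⟨x, rfl⟩ := Submodule.mkQ_surjective _ x
    refine ⟨fun h => ⟨Submodule.Quotient.mk ⟨x, (Submodule.Quotient.mk_eq_zero N).1 h⟩, rfl⟩, ?_⟩
    rintro ⟨z, hz⟩
    obtain ⟨z, rfl⟩ := Submodule.mkQ_surjective _ z
    rw [← hz]
    exact (Submodule.Quotient.mk_eq_zero N).2 z.2
  have hg : Function.Surjective g := Submodule.factor_surjective _
  exact Module.Finite.of_exact (f := f.restrictScalars K) (g := g.restrictScalars K) hfg hg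

theorem Ideal.finite_quotient_pow_smul_top [IsNoetherianRing A] [Module.Finite A M] {J : Ideal A}
    [Module.Finite K (A ⧸ J)] (n : ℕ) :
    Module.Finite K (M ⧸ J ^ n • (⊤ : Submodule A M)) := by
  induction n with
  | zero =>
    rw [pow_zero, Ideal.one_eq_top, Submodule.top_smul]
    infer_instance
  | succ n ih =>
    rw [pow_succ', mul_smul]
    exact Submodule.finite_quotient_smul_of_fg (IsNoetherian.noetherian _)

theorem Ideal.finite_quotient_comap (σ : A →ₐ[K] A)
    (I : Ideal A) [Module.Finite K (A ⧸ I)] : Module.Finite K (A ⧸ I.comap σ) :=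
  Module.Finite.of_injective (Ideal.quotientMapₐ I σ le_rfl).toLinearMap
    Ideal.quotientMap_injective

end Codim

/-! ### The Gauss norm on the Tate algebra -/

namespace TateAlgebra

section Norm

variable {K : Type*} [NormedField K] [IsUltrametricDist K] {n : ℕ}

/-- The coefficient of a restricted power series. -/
noncomputable def coeff (i : Fin n →₀ ℕ) : tateAlgebra K n →ₗ[K] K :=
  (MvPowerSeries.coeff i).comp (tateAlgebra K n).val.toLinearMap

theorem coeff_apply (i : Fin n →₀ ℕ) (f : tateAlgebra K n) :
    coeff i f = MvPowerSeries.coeff i (f : MvPowerSeries (Fin n) K) := rfl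

@[ext]
theorem ext {f g : tateAlgebra K n} (h : ∀ i, coeff i f = coeff i g) : f = g :=
  Subtype.ext (MvPowerSeries.ext h)

theorem tendsto_coeff (f : tateAlgebra K n) :
    Tendsto (fun i => ‖coeff i f‖) cofinite (𝓝 0) :=
  mem_tateAlgebra.1 f.2

theorem coeff_mul (i : Fin n →₀ ℕ) (f g : tateAlgebra K n) :
    coeff i (f * g) = ∑ p ∈ Finset.HasAntidiagonal.antidiagonal i, coeff p.1 f * coeff p.2 g := by
  simp [coeff_apply, MvPowerSeries.coeff_mul]

theorem coeff_one (i : Fin n →₀ ℕ) :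
    coeff i (1 : tateAlgebra K n) = if i = 0 then 1 else 0 := by
  classical
  simp [coeff_apply, MvPowerSeries.coeff_one]

/-- The bounded family of the coefficients of a restricted power series. -/
noncomputable def toLp : tateAlgebra K n →+ lp (fun _ : Fin n →₀ ℕ => K) ⊤ where
  toFun f := ⟨fun i => coeff i f, memℓp_infty (tendsto_coeff f).bddAbove_range_of_cofinite⟩
  map_zero' := by ext; simp
  map_add' f g := by ext i; exact map_add (coeff i) f g

theorem toLp_injective : Function.Injective (toLp (K := K) (n := n)) := fun _ _ h =>
  ext fun i => congrArg (fun a : lp (fun _ : Fin n →₀ ℕ => K) ⊤ => a i) h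

noncomputable instance : NormedAddCommGroup (tateAlgebra K n) :=
  NormedAddCommGroup.induced _ _ toLp toLp_injective

theorem norm_coeff_le (f : tateAlgebra K n) (i : Fin n →₀ ℕ) : ‖coeff i f‖ ≤ ‖f‖ :=
  lp.norm_apply_le_norm ENNReal.top_ne_zero (toLp f) i

theorem norm_le_iff {f : tateAlgebra K n} {c : ℝ} : ‖f‖ ≤ c ↔ ∀ i, ‖coeff i f‖ ≤ c :=
  ⟨fun h i => (norm_coeff_le f i).trans h, fun h => lp.norm_le_of_forall_le' (f := toLp f) c h⟩

instance : IsUltrametricDist (tateAlgebra K n) :=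
  IsUltrametricDist.isUltrametricDist_of_forall_norm_add_le_max_norm fun f g =>
    norm_le_iff.2 fun i => by
      rw [map_add]
      exact (IsUltrametricDist.norm_add_le_max _ _).trans
        (max_le_max (norm_coeff_le f i) (norm_coeff_le g i))

noncomputable instance : NormedCommRing (tateAlgebra K n) where
  __ := (inferInstance : NormedAddCommGroup (tateAlgebra K n))
  __ := (inferInstance : CommRing (tateAlgebra K n))
  norm_mul_le f g := norm_le_iff.2 fun i => by
    rw [coeff_mul]
    refine IsUltrametricDist.norm_sum_le_of_forall_le_of_nonneg
      (mul_nonneg (norm_nonneg f) (norm_nonneg g)) fun p _ => ?_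
    rw [norm_mul]
    exact mul_le_mul (norm_coeff_le f _) (norm_coeff_le g _) (norm_nonneg _) (norm_nonneg f)

noncomputable instance : NormedAlgebra K (tateAlgebra K n) where
  norm_smul_le a f := norm_le_iff.2 fun i => by
    rw [map_smul, norm_smul]
    exact mul_le_mul_of_nonneg_left (norm_coeff_le f i) (norm_nonneg a)

instance : NormOneClass (tateAlgebra K n) where
  norm_one := by
    refine le_antisymm (norm_le_iff.2 fun i => ?_) ?_
    · rw [coeff_one]; split_ifs <;> simp
    · simpa [coeff_one] using norm_coeff_le (1 : tateAlgebra K n) 0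

theorem finite_lt_norm_coeff (f : tateAlgebra K n) {ε : ℝ} (hε : 0 < ε) :
    {i | ε < ‖coeff i f‖}.Finite := by
  have := (tendsto_coeff f).eventually (gt_mem_nhds hε)
  rw [Filter.eventually_cofinite] at this
  exact this.subset fun i hi => not_lt.2 (le_of_lt hi)

/-- Only finitely many coefficients exceed half the norm. Since the maximum is attained, a nonzero
series can be scaled to norm one by an element of `K`. -/
theorem exists_norm_coeff_eq (f : tateAlgebra K n) : ∃ i, ‖coeff i f‖ = ‖f‖ := by
  rcases eq_or_ne f 0 with rfl | hf
  · exact ⟨0, by simp⟩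
  have hpos : 0 < ‖f‖ := norm_pos_iff.2 hf
  have hfin := finite_lt_norm_coeff f (half_pos hpos)
  have hne : {i | ‖f‖ / 2 < ‖coeff i f‖}.Nonempty := by
    by_contra h
    have : ‖f‖ ≤ ‖f‖ / 2 := norm_le_iff.2 fun i => not_lt.1 fun hi => h ⟨i, hi⟩
    linarith
  obtain ⟨i, hi, hmax⟩ := Set.exists_max_image _ (fun i => ‖coeff i f‖) hfin hne
  refine ⟨i, le_antisymm (norm_coeff_le f i) (norm_le_iff.2 fun j => ?_)⟩
  by_cases hj : ‖f‖ / 2 < ‖coeff j f‖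
  · exact hmax j hj
  · exact (not_lt.1 hj).trans (le_of_lt hi)

/-- Families tending to zero are closed in `ℓ^∞`, as this property passes to uniform limits. -/
instance [CompleteSpace K] : CompleteSpace (tateAlgebra K n) := by
  have hiso : Isometry (toLp (K := K) (n := n)) :=
    AddMonoidHomClass.isometry_of_norm _ fun _ => rfl
  have hcl : IsClosed (Set.range (toLp (K := K) (n := n))) := by
    refine isClosed_of_closure_subset fun g hg => ?_
    have hlim : Tendsto (fun i => ‖g i‖) cofinite (𝓝 0) := by
      rw [Metric.tendsto_nhds]
      intro ε hε
      obtain ⟨_, ⟨f, rfl⟩, hf⟩ := Metric.mem_closure_iff.1 hg ε hε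
      filter_upwards [(tendsto_coeff f).eventually (gt_mem_nhds hε)] with i hi
      have h1 : ‖(g - toLp f) i‖ < ε :=
        (lp.norm_apply_le_norm ENNReal.top_ne_zero _ i).trans_lt (by rwa [← dist_eq_norm])
      have h2 : g i = (g - toLp f) i + coeff i f := by
        rw [lp.coeFn_sub]; exact (sub_add_cancel _ _).symm
      rw [dist_zero_right, norm_norm, h2]
      exact (IsUltrametricDist.norm_add_le_max _ _).trans_lt (max_lt h1 hi)
    exact ⟨⟨fun i => g i, mem_tateAlgebra.2 hlim⟩, by ext; rfl⟩
  exact (completeSpace_iff_isComplete_range hiso.isUniformInducing).2 hcl.isComplete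

end Norm

/-! ### Evaluation of restricted power series -/

section Eval

theorem tsum_mul_tsum_eq_tsum_sum_antidiagonal {B : Type*} [NormedRing B] [CompleteSpace B]
    [IsUltrametricDist B] {n : ℕ} {a b : (Fin n →₀ ℕ) → B}
    (ha : Summable a) (hb : Summable b) : (∑' i, a i) * ∑' i, b i =
      ∑' i, ∑ p ∈ Finset.HasAntidiagonal.antidiagonal i, a p.1 * b p.2 := by
  have : NonarchimedeanRing B := ⟨NonarchimedeanAddGroup.is_nonarchimedean⟩
  exact ha.tsum_mul_tsum_eq_tsum_sum_antidiagonal hb (ha.mul_of_nonarchimedean hb)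

variable {K : Type*} [NormedField K] [IsUltrametricDist K] {n : ℕ}
  {B : Type*} [NormedCommRing B] [NormedAlgebra K B] {y : Fin n → B}

theorem tsum_coeff_one_smul_monomial (y : Fin n → B) :
    ∑' i : Fin n →₀ ℕ, coeff i (1 : tateAlgebra K n) • (i.prod fun j k => y j ^ k) = 1 := by
  rw [tsum_eq_single 0 fun i hi => by simp [coeff_one, hi]]
  simp [coeff_one]

theorem coeff_mul_smul_monomial (y : Fin n → B) (f g : tateAlgebra K n) (i : Fin n →₀ ℕ) :
    coeff i (f * g) • (i.prod fun j k => y j ^ k) =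
      ∑ p ∈ Finset.HasAntidiagonal.antidiagonal i, (coeff p.1 f • p.1.prod fun j k => y j ^ k) *
        coeff p.2 g • p.2.prod fun j k => y j ^ k := by
  rw [coeff_mul, Finset.sum_smul]
  refine Finset.sum_congr rfl fun p hp => ?_
  rw [← Finset.HasAntidiagonal.mem_antidiagonal.1 hp, smul_mul_smul_comm,
    Finsupp.prod_add_index' (fun _ => pow_zero _) (fun _ _ _ => pow_add _ _ _)]

variable [NormOneClass B]

theorem norm_monomial_le_one (hy : ∀ j, ‖y j‖ ≤ 1) (i : Fin n →₀ ℕ) :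
    ‖i.prod fun j k => y j ^ k‖ ≤ 1 :=
  (Finset.norm_prod_le _ _).trans <| Finset.prod_le_one (fun _ _ => norm_nonneg _) fun j _ =>
    (norm_pow_le _ _).trans (pow_le_one₀ (norm_nonneg _) (hy j))

theorem norm_coeff_smul_monomial_le (hy : ∀ j, ‖y j‖ ≤ 1) (f : tateAlgebra K n)
    (i : Fin n →₀ ℕ) : ‖coeff i f • i.prod fun j k => y j ^ k‖ ≤ ‖coeff i f‖ :=
  (norm_smul_le _ _).trans (mul_le_of_le_one_right (norm_nonneg _) (norm_monomial_le_one hy i))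

variable [CompleteSpace B] [IsUltrametricDist B]

theorem summable_coeff_smul_monomial (hy : ∀ j, ‖y j‖ ≤ 1) (f : tateAlgebra K n) :
    Summable fun i : Fin n →₀ ℕ => coeff i f • i.prod fun j k => y j ^ k :=
  NonarchimedeanAddGroup.summable_of_tendsto_cofinite_zero <|
    squeeze_zero_norm (norm_coeff_smul_monomial_le hy f) (tendsto_coeff f)

theorem tsum_coeff_mul_smul_monomial (hy : ∀ j, ‖y j‖ ≤ 1) (f g : tateAlgebra K n) :
    ∑' i : Fin n →₀ ℕ, coeff i (f * g) • (i.prod fun j k => y j ^ k) =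
      (∑' i : Fin n →₀ ℕ, coeff i f • i.prod fun j k => y j ^ k) *
        ∑' i : Fin n →₀ ℕ, coeff i g • i.prod fun j k => y j ^ k := by
  rw [tsum_mul_tsum_eq_tsum_sum_antidiagonal (summable_coeff_smul_monomial hy f)
    (summable_coeff_smul_monomial hy g)]
  exact tsum_congr fun i => coeff_mul_smul_monomial y f g i

/-- Evaluation of restricted power series at elements of norm at most one of an ultrametric Banach
algebra. -/
noncomputable def eval (y : Fin n → B) (hy : ∀ j, ‖y j‖ ≤ 1) : tateAlgebra K n →ₐ[K] B :=
  AlgHom.ofLinearMap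
    { toFun := fun f => ∑' i : Fin n →₀ ℕ, coeff i f • i.prod fun j k => y j ^ k
      map_add' := fun f g => by
        simp_rw [map_add, add_smul]
        exact (summable_coeff_smul_monomial hy f).tsum_add (summable_coeff_smul_monomial hy g)
      map_smul' := fun a f => by
        simp_rw [map_smul, smul_assoc]
        exact (summable_coeff_smul_monomial hy f).tsum_const_smul a }
    (tsum_coeff_one_smul_monomial y) (tsum_coeff_mul_smul_monomial hy)

theorem eval_apply (hy : ∀ j, ‖y j‖ ≤ 1) (f : tateAlgebra K n) :
    eval y hy f = ∑' i : Fin n →₀ ℕ, coeff i f • i.prod fun j k => y j ^ k := rfl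

theorem norm_eval_le (hy : ∀ j, ‖y j‖ ≤ 1) (f : tateAlgebra K n) : ‖eval y hy f‖ ≤ ‖f‖ :=
  IsUltrametricDist.norm_tsum_le_of_forall_le_of_nonneg (norm_nonneg f) fun i =>
    (norm_coeff_smul_monomial_le hy f i).trans (norm_coeff_le f i)

end Eval

/-! ### Polynomials inside the Tate algebra -/

section Polynomial

variable {K : Type*} [NormedField K] [IsUltrametricDist K] {n : ℕ}

/-- The variables of the Tate algebra. -/
noncomputable def X (j : Fin n) : tateAlgebra K n :=
  ⟨MvPowerSeries.X j, MvPowerSeries.isRestricted_monomial _ _ _⟩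

variable (K n) in
/-- The inclusion of the polynomials into the Tate algebra. -/
noncomputable def ofMvPolynomial : MvPolynomial (Fin n) K →ₐ[K] tateAlgebra K n :=
  MvPolynomial.aeval X

theorem coeff_ofMvPolynomial (p : MvPolynomial (Fin n) K) (i : Fin n →₀ ℕ) :
    coeff i (ofMvPolynomial K n p) = p.coeff i := by
  have : (tateAlgebra K n).val.comp (ofMvPolynomial K n) =
      MvPolynomial.coeToMvPowerSeries.algHom K := by
    refine MvPolynomial.algHom_ext fun j => ?_
    simp [ofMvPolynomial, X]
  have h := DFunLike.congr_fun this p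
  simpa [coeff_apply] using congrArg (MvPowerSeries.coeff i) h

theorem eval_X {B : Type*} [NormedCommRing B] [IsUltrametricDist B] [NormOneClass B]
    [NormedAlgebra K B] [CompleteSpace B] {y : Fin n → B} (hy : ∀ j, ‖y j‖ ≤ 1) (j : Fin n) :
    eval y hy (X (K := K) j) = y j := by
  classical
  have h (i : Fin n →₀ ℕ) : coeff i (X (K := K) j) = if i = Finsupp.single j 1 then 1 else 0 := by
    simp [coeff_apply, X, MvPowerSeries.coeff_X]
  rw [eval_apply, tsum_eq_single (Finsupp.single j 1) fun i hi => by simp [h, hi]]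
  simp [h]

theorem eval_ofMvPolynomial {B : Type*} [NormedCommRing B] [IsUltrametricDist B]
    [NormOneClass B] [NormedAlgebra K B] [CompleteSpace B] {y : Fin n → B}
    (hy : ∀ j, ‖y j‖ ≤ 1) (p : MvPolynomial (Fin n) K) :
    eval y hy (ofMvPolynomial K n p) = MvPolynomial.aeval y p := by
  have : (eval y hy).comp (ofMvPolynomial K n) = MvPolynomial.aeval y :=
    MvPolynomial.algHom_ext fun j => by simp [ofMvPolynomial, eval_X hy]
  exact DFunLike.congr_fun this p

end Polynomial

end TateAlgebra

/-! ### Successive approximation -/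

/-- A continuous linear map between Banach spaces is surjective as soon as every vector is
approximated, up to a fixed factor less than one, by the image of a vector which is not longer. -/
theorem ContinuousLinearMap.surjective_of_exists_norm_sub_le {K V W : Type*} [NormedField K]
    [NormedAddCommGroup V] [NormedSpace K V] [CompleteSpace V] [NormedAddCommGroup W]
    [NormedSpace K W] (L : V →L[K] W) {ε : ℝ} (hε0 : 0 ≤ ε) (hε : ε < 1)
    (h : ∀ w, ∃ v, ‖v‖ ≤ ‖w‖ ∧ ‖w - L v‖ ≤ ε * ‖w‖) : Function.Surjective L := by
  choose v hv hw using h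
  intro w
  -- The residuals `r k` decay geometrically, so the corrections `v (r k)` sum to a preimage of `w`.
  let r : ℕ → W := fun k => (fun z => z - L (v z))^[k] w
  have hr (k : ℕ) : r (k + 1) = r k - L (v (r k)) := Function.iterate_succ_apply' _ _ _
  have hnorm (k : ℕ) : ‖r k‖ ≤ ε ^ k * ‖w‖ := by
    induction k with
    | zero => simp [r]
    | succ k ih =>
      rw [hr, pow_succ', mul_assoc]
      exact (hw _).trans (mul_le_mul_of_nonneg_left ih hε0)
  have hgeo : Summable fun k => ε ^ k * ‖w‖ := (summable_geometric_of_lt_one hε0 hε).mul_right _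
  have hsum : Summable fun k => v (r k) :=
    Summable.of_norm_bounded hgeo fun k => (hv _).trans (hnorm k)
  have hr0 : Tendsto r atTop (𝓝 0) :=
    squeeze_zero_norm hnorm hgeo.tendsto_atTop_zero
  have hpart (N : ℕ) : L (∑ k ∈ Finset.range N, v (r k)) = w - r N := by
    induction N with
    | zero => simp [r]
    | succ N ih => rw [Finset.sum_range_succ, map_add, ih, hr]; abel
  refine ⟨∑' k, v (r k), tendsto_nhds_unique
    ((L.continuous.tendsto _).comp hsum.hasSum.tendsto_sum_nat) ?_⟩
  simpa [Function.comp_def, hpart] using hr0.const_sub w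

namespace TateAlgebra

/-! ### Reduction to the residue field -/

section Reduction

variable {K : Type*} [NormedField K] [IsUltrametricDist K] {n : ℕ}

variable (K) in
/-- The ring of integers of an ultrametric field. -/
noncomputable abbrev integers : ValuationSubring K := (NormedField.valuation (K := K)).valuationSubring

theorem norm_integers_le_one (a : integers K) : ‖(a : K)‖ ≤ 1 := a.2

theorem norm_lt_one_of_residue_eq_zero {a : integers K}
    (ha : IsLocalRing.residue (integers K) a = 0) : ‖(a : K)‖ < 1 :=
  (NormedField.valuation (K := K)).mem_maximalIdeal_iff.1 ((IsLocalRing.residue_eq_zero_iff a).1 ha)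

variable (K n) in
/-- The inclusion of the polynomials with integral coefficients into the Tate algebra. -/
noncomputable def ofInt : MvPolynomial (Fin n) (integers K) →+* tateAlgebra K n :=
  (ofMvPolynomial K n : MvPolynomial (Fin n) K →+* tateAlgebra K n).comp
    (MvPolynomial.map (integers K).subtype)

theorem ofInt_apply (p : MvPolynomial (Fin n) (integers K)) :
    ofInt K n p = ofMvPolynomial K n (MvPolynomial.map (integers K).subtype p) := rfl

theorem coeff_ofInt (p : MvPolynomial (Fin n) (integers K)) (i : Fin n →₀ ℕ) :
    coeff i (ofInt K n p) = ((MvPolynomial.coeff i p : integers K) : K) := by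
  rw [ofInt_apply, coeff_ofMvPolynomial, MvPolynomial.coeff_map]
  rfl

theorem norm_ofInt_le_one (p : MvPolynomial (Fin n) (integers K)) : ‖ofInt K n p‖ ≤ 1 :=
  norm_le_iff.2 fun i => by rw [coeff_ofInt]; exact norm_integers_le_one _

variable (K n) in
/-- The reduction of polynomials with integral coefficients. -/
noncomputable abbrev reduction : MvPolynomial (Fin n) (integers K) →+*
    MvPolynomial (Fin n) (IsLocalRing.ResidueField (integers K)) :=
  MvPolynomial.map (IsLocalRing.residue (integers K))

theorem reduction_surjective : Function.Surjective (reduction K n) :=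
  MvPolynomial.map_surjective _ IsLocalRing.residue_surjective

theorem norm_ofInt_lt_one {p : MvPolynomial (Fin n) (integers K)} (hp : reduction K n p = 0) :
    ‖ofInt K n p‖ < 1 := by
  obtain ⟨i, hi⟩ := exists_norm_coeff_eq (ofInt K n p)
  rw [← hi, coeff_ofInt]
  refine norm_lt_one_of_residue_eq_zero ?_
  rw [← MvPolynomial.coeff_map, hp, MvPolynomial.coeff_zero]

/-- Keep the finitely many coefficients larger than `ε`. This lets reduction be used on polynomials
only. -/
theorem exists_norm_sub_ofInt_le {f : tateAlgebra K n} (hf : ‖f‖ ≤ 1) {ε : ℝ} (hε : 0 < ε) :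
    ∃ p, ‖f - ofInt K n p‖ ≤ ε := by
  classical
  let S := (finite_lt_norm_coeff f hε).toFinset
  let p : MvPolynomial (Fin n) (integers K) := ∑ i ∈ S,
    MvPolynomial.monomial i ⟨coeff i f, (norm_coeff_le f i).trans hf⟩
  refine ⟨p, norm_le_iff.2 fun i => ?_⟩
  rw [map_sub, coeff_ofInt, MvPolynomial.coeff_sum]
  simp only [MvPolynomial.coeff_monomial, Finset.sum_ite_eq']
  by_cases hi : i ∈ S
  · simp [hi, hε.le]
  · simpa [hi] using show ‖coeff i f‖ ≤ ε by simpa [S] using hi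

theorem eval_ofInt {s : ℕ} [CompleteSpace K] (y : Fin s → MvPolynomial (Fin n) (integers K))
    (p : MvPolynomial (Fin s) (integers K)) :
    eval (fun j => ofInt K n (y j)) (fun j => norm_ofInt_le_one (y j)) (ofInt K s p) =
      ofInt K n (MvPolynomial.bind₁ y p) := by
  rw [ofInt_apply, eval_ofMvPolynomial]
  induction p using MvPolynomial.induction_on with
  | C a => simp [ofInt_apply]
  | add p q hp hq => simp [hp, hq]
  | mul_X p j hp => simp [hp]

end Reduction

/-! ### Lifting generators from the reduction -/

section Normalization

variable {K : Type*} [NormedField K] [IsUltrametricDist K] {n : ℕ}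

/-- A lift `q` of the inverse of the reduction gives `‖1 - f q‖ < 1`, so `f q` is invertible by the
geometric series. -/
theorem isUnit_of_span_reduction_eq_top [CompleteSpace K] {f : tateAlgebra K n}
    {p : MvPolynomial (Fin n) (integers K)} (hp : ‖f - ofInt K n p‖ < 1)
    (h : Ideal.span {reduction K n p} = ⊤) : IsUnit f := by
  obtain ⟨q, hq⟩ := (Ideal.span_singleton_eq_top.1 h).exists_right_inv
  obtain ⟨q, rfl⟩ := reduction_surjective q
  have h1 : ‖1 - ofInt K n (p * q)‖ < 1 := by
    rw [← map_one (ofInt K n), ← map_sub]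
    exact norm_ofInt_lt_one (by rw [map_sub, map_mul, hq, map_one, sub_self])
  have h2 : ‖(f - ofInt K n p) * ofInt K n q‖ < 1 :=
    (norm_mul_le _ _).trans_lt
      ((mul_le_of_le_one_right (norm_nonneg _) (norm_ofInt_le_one q)).trans_lt hp)
  have h3 : ‖1 - f * ofInt K n q‖ < 1 := by
    have : 1 - f * ofInt K n q = (1 - ofInt K n (p * q)) - (f - ofInt K n p) * ofInt K n q := by
      rw [map_mul]; ring
    rw [this, sub_eq_add_neg]
    exact (IsUltrametricDist.norm_add_le_max _ _).trans_lt (max_lt h1 (by rwa [norm_neg]))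
  have h4 : IsUnit (f * ofInt K n q) := by
    simpa using isUnit_one_sub_of_norm_lt_one h3
  exact isUnit_of_mul_isUnit_left h4

/-- The linear map `(h, q) ↦ ∑ φ(hₗ) eₗ + q f`. -/
noncomputable def combination {s m : ℕ} (φ : tateAlgebra K s →ₐ[K] tateAlgebra K n)
    (e : Fin m → tateAlgebra K n) (f : tateAlgebra K n) :
    (Fin m → tateAlgebra K s) × tateAlgebra K n →ₗ[K] tateAlgebra K n :=
  LinearMap.coprod
    (∑ l, (LinearMap.mulRight K (e l)).comp (φ.toLinearMap.comp (LinearMap.proj l)))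
    (LinearMap.mulRight K f)

variable {s m : ℕ} {φ : tateAlgebra K s →ₐ[K] tateAlgebra K n}
  {e : Fin m → tateAlgebra K n} {f : tateAlgebra K n}

theorem combination_apply (h : Fin m → tateAlgebra K s) (q : tateAlgebra K n) :
    combination φ e f (h, q) = ∑ l, φ (h l) * e l + q * f := by
  simp [combination]

theorem norm_combination_le (hφ : ∀ t, ‖φ t‖ ≤ ‖t‖) (he : ∀ l, ‖e l‖ ≤ 1) (hf : ‖f‖ ≤ 1)
    (x : (Fin m → tateAlgebra K s) × tateAlgebra K n) : ‖combination φ e f x‖ ≤ ‖x‖ := by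
  obtain ⟨h, q⟩ := x
  have hh : ‖h‖ ≤ ‖(h, q)‖ := norm_fst_le (h, q)
  have hq : ‖q‖ ≤ ‖(h, q)‖ := norm_snd_le (h, q)
  rw [combination_apply]
  refine (IsUltrametricDist.norm_add_le_max _ _).trans (max_le ?_ ?_)
  · refine IsUltrametricDist.norm_sum_le_of_forall_le_of_nonneg (norm_nonneg _) fun l _ => ?_
    exact (norm_mul_le _ _).trans ((mul_le_of_le_one_right (norm_nonneg _) (he l)).trans
      ((hφ _).trans ((norm_le_pi_norm h l).trans hh)))
  · exact (norm_mul_le _ _).trans ((mul_le_of_le_one_right (norm_nonneg _) hf).trans hq)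

/-- The restricted power series which are, up to `ε`, combinations with coefficients of norm at
most one. -/
def approximable (φ : tateAlgebra K s →ₐ[K] tateAlgebra K n) (e : Fin m → tateAlgebra K n)
    (f : tateAlgebra K n) {ε : ℝ} (hε : 0 ≤ ε) : AddSubgroup (tateAlgebra K n) where
  carrier := {g | ∃ x, ‖x‖ ≤ 1 ∧ ‖g - combination φ e f x‖ ≤ ε}
  zero_mem' := ⟨0, by simp, by simpa⟩
  add_mem' := by
    rintro g g' ⟨x, hx, hg⟩ ⟨x', hx', hg'⟩
    rw [Prod.norm_def, max_le_iff] at hx hx'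
    refine ⟨x + x', max_le ((IsUltrametricDist.norm_add_le_max _ _).trans (max_le hx.1 hx'.1))
      ((IsUltrametricDist.norm_add_le_max _ _).trans (max_le hx.2 hx'.2)), ?_⟩
    rw [map_add, add_sub_add_comm]
    exact (IsUltrametricDist.norm_add_le_max _ _).trans (max_le hg hg')
  neg_mem' := by
    rintro g ⟨x, hx, hg⟩
    refine ⟨-x, by rwa [norm_neg], ?_⟩
    rwa [map_neg, ← neg_sub', norm_neg]

theorem mul_mem_approximable (hφ : ∀ t, ‖φ t‖ ≤ ‖t‖) {ε : ℝ} (hε : 0 ≤ ε)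
    {t : tateAlgebra K s} (ht : ‖t‖ ≤ 1) {g : tateAlgebra K n}
    (hg : g ∈ approximable φ e f hε) : φ t * g ∈ approximable φ e f hε := by
  obtain ⟨⟨h, q⟩, hx, hg⟩ := hg
  have hφt : ‖φ t‖ ≤ 1 := (hφ t).trans ht
  refine ⟨(fun l => t * h l, φ t * q), ?_, ?_⟩
  · rw [Prod.norm_mk, max_le_iff] at hx ⊢
    refine ⟨(pi_norm_le_iff_of_nonneg zero_le_one).2 fun l => ?_, ?_⟩
    · exact (norm_mul_le _ _).trans (mul_le_one₀ ht (norm_nonneg _)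
        ((norm_le_pi_norm h l).trans hx.1))
    · exact (norm_mul_le _ _).trans (mul_le_one₀ hφt (norm_nonneg _) hx.2)
  · have : φ t * g - combination φ e f (fun l => t * h l, φ t * q) =
        φ t * (g - combination φ e f (h, q)) := by
      simp only [combination_apply, map_mul, mul_sub, mul_add, Finset.mul_sum, mul_assoc]
    rw [this]
    exact (norm_mul_le _ _).trans ((mul_le_of_le_one_left (norm_nonneg _) hφt).trans hg)

theorem mem_approximable_of_norm_le {ε : ℝ} (hε : 0 ≤ ε) {g : tateAlgebra K n} (hg : ‖g‖ ≤ ε) :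
    g ∈ approximable φ e f hε :=
  ⟨0, by simp, by simpa⟩

theorem mul_right_mem_approximable {ε : ℝ} (hε : 0 ≤ ε) {q : tateAlgebra K n} (hq : ‖q‖ ≤ 1) :
    q * f ∈ approximable φ e f hε :=
  ⟨(0, q), by simpa [Prod.norm_mk], by simp [combination_apply, hε]⟩

theorem X_mul_mem_approximable (hφ : ∀ t, ‖φ t‖ ≤ ‖t‖) {ε : ℝ} (hε : 0 ≤ ε) (j : Fin n)
    (hX : ‖X (K := K) j‖ ≤ 1) (hXe : ∀ l, X j * e l ∈ approximable φ e f hε) {g : tateAlgebra K n}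
    (hg : g ∈ approximable φ e f hε) : X j * g ∈ approximable φ e f hε := by
  obtain ⟨⟨h, q⟩, hx, hg⟩ := hg
  rw [Prod.norm_mk, max_le_iff] at hx
  have : X j * g = ∑ l, φ (h l) * (X j * e l) + (X j * q) * f +
      X j * (g - combination φ e f (h, q)) := by
    rw [combination_apply, mul_sub, mul_add, Finset.mul_sum]
    simp only [mul_left_comm (X j), mul_assoc]
    ring
  rw [this]
  refine add_mem (add_mem (sum_mem fun l _ => mul_mem_approximable hφ hε ?_ (hXe l)) ?_) ?_
  · exact (norm_le_pi_norm h l).trans hx.1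
  · exact mul_right_mem_approximable hε
      ((norm_mul_le _ _).trans (mul_le_one₀ hX (norm_nonneg _) hx.2))
  · exact mem_approximable_of_norm_le hε
      ((norm_mul_le _ _).trans ((mul_le_of_le_one_left (norm_nonneg _) hX).trans hg))

theorem ofInt_X (j : Fin n) : ofInt K n (MvPolynomial.X j) = X j := by
  simp [ofInt_apply, ofMvPolynomial]

theorem norm_X_le_one (j : Fin n) : ‖X (K := K) j‖ ≤ 1 := by
  rw [← ofInt_X]; exact norm_ofInt_le_one _

/-- Finitely many conditions suffice: building polynomials up one variable at a time never worsens
the error, which is ultrametric. This yields an `ε` uniform over the unit ball even when the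
valuation is not discrete. -/
theorem mem_approximable (hφ : ∀ t, ‖φ t‖ ≤ ‖t‖) {ε : ℝ} (hε : 0 < ε)
    (h1 : 1 ∈ approximable φ e f hε.le)
    (hXe : ∀ j l, X j * e l ∈ approximable φ e f hε.le) {g : tateAlgebra K n} (hg : ‖g‖ ≤ 1) :
    g ∈ approximable φ e f hε.le := by
  obtain ⟨p, hp⟩ := exists_norm_sub_ofInt_le hg hε
  rw [← sub_add_cancel g (ofInt K n p)]
  refine add_mem (mem_approximable_of_norm_le hε.le hp) ?_
  clear hp
  induction p using MvPolynomial.induction_on with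
  | C a =>
    have : ofInt K n (MvPolynomial.C a) = φ (ofInt K s (MvPolynomial.C a)) * 1 := by
      rw [mul_one, ofInt_apply, ofInt_apply, MvPolynomial.map_C, MvPolynomial.map_C,
        ← MvPolynomial.algebraMap_eq, ← MvPolynomial.algebraMap_eq, AlgHom.commutes,
        AlgHom.commutes, AlgHom.commutes]
    rw [this]
    exact mul_mem_approximable hφ hε.le (norm_ofInt_le_one _) h1
  | add p q hp hq => rw [map_add]; exact add_mem hp hq
  | mul_X p j hp =>
    rw [map_mul, mul_comm, ofInt_X]
    exact X_mul_mem_approximable hφ hε.le j (norm_X_le_one j) (hXe j) hp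

theorem combination_surjective [CompleteSpace K] (hφ : ∀ t, ‖φ t‖ ≤ ‖t‖) (he : ∀ l, ‖e l‖ ≤ 1) (hf : ‖f‖ ≤ 1)
    {ε : ℝ} (hε : 0 < ε) (hε1 : ε < 1) (h1 : 1 ∈ approximable φ e f hε.le)
    (hXe : ∀ j l, X j * e l ∈ approximable φ e f hε.le) :
    Function.Surjective (combination φ e f) := by
  let L := (combination φ e f).mkContinuous 1
    fun x => by rw [one_mul]; exact norm_combination_le hφ he hf x
  refine L.surjective_of_exists_norm_sub_le hε.le hε1 fun g => ?_
  rcases eq_or_ne g 0 with rfl | hg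
  · exact ⟨0, by simp⟩
  obtain ⟨i, hi⟩ := exists_norm_coeff_eq g
  have ha : coeff i g ≠ 0 := by rwa [← norm_ne_zero_iff, hi, norm_ne_zero_iff]
  -- Dividing by a coefficient of maximal norm brings `g` to norm one.
  obtain ⟨x, hx, hgx⟩ := mem_approximable hφ hε h1 hXe (g := (coeff i g)⁻¹ • g) (by
    rw [norm_smul, norm_inv, hi, inv_mul_cancel₀ (norm_ne_zero_iff.2 hg)])
  refine ⟨coeff i g • x, ?_, ?_⟩
  · rw [norm_smul, hi]
    exact mul_le_of_le_one_right (norm_nonneg g) hx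
  · have : g - L (coeff i g • x) = coeff i g • ((coeff i g)⁻¹ • g - combination φ e f x) := by
      rw [smul_sub, smul_inv_smul₀ ha, map_smul]
      rfl
    rw [this, norm_smul, hi, mul_comm]
    exact mul_le_mul_of_nonneg_right hgx (norm_nonneg g)

end Normalization

end TateAlgebra

/-! ### Normalization of hypersurfaces, Noetherianity and the Nullstellensatz -/

namespace TateAlgebra

section

variable {K : Type*} [NormedField K] [IsUltrametricDist K]

theorem eq_zero_of_isField {n : ℕ} (h : IsField (tateAlgebra K n)) : n = 0 := by
  by_contra hn
  let j : Fin n := ⟨0, Nat.pos_of_ne_zero hn⟩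
  have h0 (f : tateAlgebra K n) : coeff 0 (X j * f) = 0 := by
    simp [coeff_apply, X]
  obtain ⟨f, hf⟩ := h.mul_inv_cancel (a := X j) fun hX => by
    have := congrArg (coeff (Finsupp.single j 1)) hX
    simp [coeff_apply, X, MvPowerSeries.coeff_X] at this
  have := h0 f
  rw [hf, coeff_one] at this
  simp at this

theorem finite_zero_variables : Module.Finite K (tateAlgebra K 0) := by
  refine Module.Finite.of_surjective (Algebra.linearMap K (tateAlgebra K 0)) fun f =>
    ⟨coeff 0 f, ext fun i => ?_⟩
  rw [Subsingleton.elim i 0, Algebra.linearMap_apply, Algebra.algebraMap_eq_smul_one, map_smul,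
    coeff_one]
  simp

end

section Normalization

variable {K : Type*} [NontriviallyNormedField K] [IsUltrametricDist K] [CompleteSpace K]

/-- An expression of the reduction of `p` through the generators, modulo the reduction of `f₀`, is
lifted coefficientwise. Lifting and replacing `f₀` by `f` both cost an error below one, but not a
uniform one. -/
theorem exists_norm_ofInt_sub_lt_one {n s m : ℕ}
    {f : tateAlgebra K n} {f₀ : MvPolynomial (Fin n) (integers K)}
    (hf₀ : ‖f - ofInt K n f₀‖ < 1)
    (g : MvPolynomial (Fin s) (IsLocalRing.ResidueField (integers K)) →ₐ[
      IsLocalRing.ResidueField (integers K)] MvPolynomial (Fin n)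
        (IsLocalRing.ResidueField (integers K)) ⧸ Ideal.span {reduction K n f₀})
    {y : Fin s → MvPolynomial (Fin n) (integers K)}
    (hy : ∀ j, Ideal.Quotient.mk _ (reduction K n (y j)) = g (MvPolynomial.X j))
    {e : Fin m → MvPolynomial (Fin n) (integers K)}
    (he : ∀ x, ∃ c : Fin m → MvPolynomial (Fin s) (IsLocalRing.ResidueField (integers K)),
      ∑ l, g (c l) * Ideal.Quotient.mk _ (reduction K n (e l)) = x)
    (p : MvPolynomial (Fin n) (integers K)) :
    ∃ x, ‖x‖ ≤ 1 ∧ ‖ofInt K n p - combination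
      (eval (fun j => ofInt K n (y j)) (fun j => norm_ofInt_le_one (y j)))
      (fun l => ofInt K n (e l)) f x‖ < 1 := by
  have hg (h : MvPolynomial (Fin s) (integers K)) :
      g (reduction K s h) = Ideal.Quotient.mk _ (reduction K n (MvPolynomial.bind₁ y h)) := by
    induction h using MvPolynomial.induction_on with
    | C a =>
      simp only [MvPolynomial.map_C, MvPolynomial.bind₁_C_right]
      exact g.commutes _
    | add p q hp hq => simp only [map_add, hp, hq]
    | mul_X p j hp => simp only [map_mul, hp, MvPolynomial.map_X, MvPolynomial.bind₁_X_right, hy]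
  obtain ⟨c, hc⟩ := he (Ideal.Quotient.mk _ (reduction K n p))
  choose h hh using fun l => reduction_surjective (c l)
  simp only [← hh, hg, ← map_mul, ← map_sum] at hc
  obtain ⟨q, hq⟩ := Ideal.mem_span_singleton'.1 (Ideal.Quotient.eq.1 hc.symm)
  obtain ⟨q, rfl⟩ := reduction_surjective q
  refine ⟨(fun l => ofInt K s (h l), ofInt K n q), ?_, ?_⟩
  · exact max_le ((pi_norm_le_iff_of_nonneg zero_le_one).2 fun l => norm_ofInt_le_one _)
      (norm_ofInt_le_one _)
  · rw [combination_apply]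
    simp only [eval_ofInt]
    have h1 : ‖ofInt K n (p - ∑ l, MvPolynomial.bind₁ y (h l) * e l - q * f₀)‖ < 1 := by
      refine norm_ofInt_lt_one ?_
      rw [map_sub, map_sub, map_mul, hq, sub_self]
    have h2 : ‖ofInt K n q * (ofInt K n f₀ - f)‖ < 1 := by
      rw [norm_sub_rev] at hf₀
      exact (norm_mul_le _ _).trans_lt
        ((mul_le_of_le_one_left (norm_nonneg _) (norm_ofInt_le_one q)).trans_lt hf₀)
    convert! (IsUltrametricDist.norm_add_le_max _ _).trans_lt (max_lt h1 h2) using 2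
    simp only [map_sub, map_mul, map_sum]
    ring

/-- A quotient of a Tate algebra by a non-zero element is either zero or finite over a Tate algebra
in fewer variables. -/
theorem exists_finite_algHom_quotient_span_singleton {n : ℕ} {f : tateAlgebra K n} (hf : f ≠ 0)
    (htop : Ideal.span {f} ≠ ⊤) :
    ∃ s < n, ∃ φ : tateAlgebra K s →ₐ[K] tateAlgebra K n ⧸ Ideal.span {f}, φ.Finite := by
  wlog hf1 : ‖f‖ = 1 generalizing f
  · obtain ⟨i, hi⟩ := exists_norm_coeff_eq f
    have ha : coeff i f ≠ 0 := by rwa [← norm_ne_zero_iff, hi, norm_ne_zero_iff]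
    have hspan : Ideal.span {(coeff i f)⁻¹ • f} = Ideal.span {f} := by
      rw [Algebra.smul_def]
      exact Ideal.span_singleton_mul_left_unit ((Ne.isUnit (inv_ne_zero ha)).map _) f
    rw [← hspan]
    refine this (smul_ne_zero (inv_ne_zero ha) hf) (hspan ▸ htop) ?_
    rw [norm_smul, norm_inv, hi, inv_mul_cancel₀ (norm_ne_zero_iff.2 hf)]
  obtain ⟨f₀, hf₀⟩ := exists_norm_sub_ofInt_le hf1.le (one_half_pos (α := ℝ))
  replace hf₀ : ‖f - ofInt K n f₀‖ < 1 := hf₀.trans_lt one_half_lt_one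
  have hred : reduction K n f₀ ≠ 0 := fun h => by
    have := (IsUltrametricDist.norm_add_le_max (f - ofInt K n f₀) (ofInt K n f₀)).trans_lt
      (max_lt hf₀ (norm_ofInt_lt_one h))
    rw [sub_add_cancel, hf1] at this
    exact lt_irrefl _ this
  have hredtop : Ideal.span {reduction K n f₀} ≠ ⊤ := fun h =>
    htop (Ideal.span_singleton_eq_top.2 (isUnit_of_span_reduction_eq_top hf₀ h))
  obtain ⟨s, hs, g, hg⟩ :=
    MvPolynomial.exists_finite_algHom_quotient_span_singleton hred hredtop
  have hsurj : Function.Surjective fun p =>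
      Ideal.Quotient.mk (Ideal.span {reduction K n f₀}) (reduction K n p) :=
    Ideal.Quotient.mk_surjective.comp reduction_surjective
  choose y hy using fun j => hsurj (g (MvPolynomial.X j))
  obtain ⟨m, e', he'⟩ := hg.exists_fin
  choose e he using fun l => hsurj (e' l)
  simp only [← he] at he'
  let φ : tateAlgebra K s →ₐ[K] tateAlgebra K n :=
    eval (fun j => ofInt K n (y j)) (fun j => norm_ofInt_le_one (y j))
  let E : Fin m → tateAlgebra K n := fun l => ofInt K n (e l)
  choose x hx hpx using exists_norm_ofInt_sub_lt_one hf₀ g hy he'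
  -- The finite family consisting of `1` and the products `X j * e l`. Its largest error is below
  -- one, and the maximum with `1 / 2` keeps `ε` positive.
  let P : Option (Fin n × Fin m) → MvPolynomial (Fin n) (integers K) :=
    fun i => i.elim 1 fun jl => MvPolynomial.X jl.1 * e jl.2
  obtain ⟨i₀, hi₀⟩ := Finite.exists_max fun i =>
    ‖ofInt K n (P i) - combination φ E f (x (P i))‖
  let ε := max (1 / 2) ‖ofInt K n (P i₀) - combination φ E f (x (P i₀))‖
  have hε : 0 < ε := lt_max_of_lt_left one_half_pos
  have hε1 : ε < 1 := max_lt one_half_lt_one (hpx _)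
  have hP (i) : ofInt K n (P i) ∈ approximable φ E f hε.le :=
    ⟨x (P i), hx _, (hi₀ i).trans (le_max_right _ _)⟩
  have hcomb : Function.Surjective (combination φ E f) := by
    refine combination_surjective (norm_eval_le _) (fun l => norm_ofInt_le_one _) hf1.le hε hε1
      ?_ fun j l => ?_
    · simpa [P] using hP none
    · simpa [P, ofInt_X] using hP (some (j, l))
  refine ⟨s, hs, (Ideal.Quotient.mkₐ K _).comp φ, ?_⟩
  refine RingHom.Finite.of_fin (fun l => Ideal.Quotient.mk (Ideal.span {f}) (E l)) fun z => ?_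
  obtain ⟨z, rfl⟩ := Ideal.Quotient.mk_surjective z
  obtain ⟨⟨h, q⟩, rfl⟩ := hcomb z
  refine ⟨h, ?_⟩
  rw [combination_apply, map_add, map_sum,
    Ideal.Quotient.eq_zero_iff_mem.2 (Ideal.mul_mem_left _ _ (Ideal.mem_span_singleton_self f)),
    add_zero]
  exact Finset.sum_congr rfl fun l _ => rfl

/-- For a nonzero `f ∈ I`, either `f` is a unit or the quotient by `f` is finite over a Tate algebra
in fewer variables. In the latter case `I` is finitely generated modulo `f`, hence finitely
generated. -/
instance (n : ℕ) : IsNoetherianRing (tateAlgebra K n) := by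
  induction n using Nat.strong_induction_on with
  | _ n ih =>
  refine (isNoetherianRing_iff_ideal_fg _).2 fun I => ?_
  rcases eq_or_ne I ⊥ with rfl | hI
  · exact Submodule.fg_bot
  obtain ⟨f, hfI, hf⟩ := Submodule.exists_mem_ne_zero_of_ne_bot hI
  by_cases htop : Ideal.span {f} = ⊤
  · rw [eq_top_mono ((Ideal.span_singleton_le_iff_mem I).2 hfI) htop]
    exact Module.Finite.fg_top
  obtain ⟨s, hs, φ, hφ⟩ := exists_finite_algHom_quotient_span_singleton hf htop
  have := ih s hs
  have : IsNoetherianRing (tateAlgebra K n ⧸ Ideal.span {f}) :=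
    hφ.isNoetherianRing
  refine Ideal.fg_of_fg_map_of_fg_inf_ker_of_surjective (f := Ideal.Quotient.mk (Ideal.span {f}))
    (IsNoetherian.noetherian _) ?_ Ideal.Quotient.mk_surjective
  rw [Ideal.mk_ker, inf_eq_right.2 ((Ideal.span_singleton_le_iff_mem I).2 hfI)]
  exact Submodule.fg_span_singleton f

/-- If `φ` is injective, the Tate algebra is itself a field by integrality, which forces `n = 0`.
Otherwise a nonzero element of the kernel lowers the number of variables. -/
theorem finite_of_finite_algHom {L : Type*} [Field L] [Algebra K L] {n : ℕ}
    (φ : tateAlgebra K n →ₐ[K] L) (hφ : φ.Finite) : Module.Finite K L := by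
  induction n using Nat.strong_induction_on with
  | _ n ih =>
  by_cases hinj : Function.Injective φ
  · obtain rfl := eq_zero_of_isField (hφ.isField_of_injective hinj (Field.toIsField L))
    have := finite_zero_variables (K := K)
    exact hφ.module_finite
  · obtain ⟨f, hfφ, hf⟩ : ∃ f, φ f = 0 ∧ f ≠ 0 := by
      simpa [injective_iff_map_eq_zero] using hinj
    have hle : ∀ a ∈ Ideal.span {f}, φ a = 0 := fun a ha => by
      obtain ⟨b, rfl⟩ := Ideal.mem_span_singleton'.1 ha
      rw [map_mul, hfφ, mul_zero]
    have htop : Ideal.span {f} ≠ ⊤ := fun h => one_ne_zero (α := L) <| by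
      rw [← map_one φ]
      exact hle 1 (h ▸ Submodule.mem_top)
    obtain ⟨s, hs, ψ, hψ⟩ := exists_finite_algHom_quotient_span_singleton hf htop
    have hlift : (Ideal.Quotient.liftₐ (Ideal.span {f}) φ hle).Finite :=
      AlgHom.Finite.of_comp_finite (f := Ideal.Quotient.mkₐ K (Ideal.span {f})) (by
        rwa [Ideal.Quotient.liftₐ_comp])
    exact ih s hs _ (hlift.comp hψ)

end Normalization

end TateAlgebra

/-! ### Residue fields and Krull intersection for affinoid algebras -/

section Affinoid

variable {K : Type*} [NontriviallyNormedField K] [IsUltrametricDist K] [CompleteSpace K]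
  {A : Type*} [CommRing A] [Algebra K A]

theorem IsAffinoidAlgebra.isNoetherianRing (hA : IsAffinoidAlgebra K A) : IsNoetherianRing A := by
  obtain ⟨N, π, hπ⟩ := hA
  exact isNoetherianRing_of_surjective _ _ π.toRingHom hπ

theorem IsAffinoidAlgebra.finite_quotient_of_isMaximal (hA : IsAffinoidAlgebra K A) (I : Ideal A)
    [I.IsMaximal] : Module.Finite K (A ⧸ I) := by
  obtain ⟨N, π, hπ⟩ := hA
  let := Ideal.Quotient.field I
  exact TateAlgebra.finite_of_finite_algHom ((Ideal.Quotient.mkₐ K I).comp π)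
    (AlgHom.Finite.of_surjective _ (Ideal.Quotient.mk_surjective.comp hπ))

theorem IsAffinoidAlgebra.eq_zero_of_forall_mem_pow_smul (hA : IsAffinoidAlgebra K A) {M : Type*}
    [AddCommGroup M] [Module A M] [Module.Finite A M] {x : M}
    (hx : ∀ (I : Ideal A) [I.IsMaximal] (n : ℕ), x ∈ I ^ n • (⊤ : Submodule A M)) : x = 0 := by
  have := hA.isNoetherianRing
  by_contra hx0
  have hann : Ideal.torsionOf A M x ≠ ⊤ := fun h =>
    hx0 (by simpa using h)
  -- With `I` containing the annihilator of `x`, Krull's theorem gives `r ∈ I` with `r x = x`. Then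
  -- `1 - r` kills `x` and lies in `I`, a contradiction.
  obtain ⟨I, hI, hle⟩ := Ideal.exists_le_maximal _ hann
  obtain ⟨r, hr⟩ := (I.mem_iInf_smul_pow_eq_bot_iff x).1 ((Submodule.mem_iInf _).2 fun n => hx I n)
  have h1 : 1 - (r : A) ∈ I := hle <| (Ideal.mem_torsionOf_iff x _).2 <| by
    rw [sub_smul, one_smul, hr, sub_self]
  exact hI.ne_top ((Ideal.eq_top_iff_one I).2 (by simpa using add_mem h1 r.2))

end Affinoid

/-! ### Closed submodules and continuity of twisted derivations -/

section Continuity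

variable {K : Type*} [NontriviallyNormedField K] [CompleteSpace K]

theorem Ideal.range_sum_smul_proj {A M : Type*} [CommRing A] [AddCommGroup M] [Module A M] {r : ℕ}
    (x : Fin r → A) :
    (∑ i, x i • LinearMap.proj i : (Fin r → M) →ₗ[A] M).range =
      Ideal.span (Set.range x) • (⊤ : Submodule A M) := by
  refine le_antisymm ?_ (Submodule.smul_le.2 fun a ha m _ => ?_)
  · rintro _ ⟨m, rfl⟩
    rw [LinearMap.sum_apply]
    exact Submodule.sum_mem _ fun i _ =>
      Submodule.smul_mem_smul (Ideal.subset_span ⟨i, rfl⟩) Submodule.mem_top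
  · obtain ⟨c, rfl⟩ := (Submodule.mem_span_range_iff_exists_fun A).1 ha
    refine ⟨fun i => c i • m, ?_⟩
    simp [LinearMap.sum_apply, Finset.sum_smul, smul_smul, mul_comm]

/-- In a Banach module, the products of the whole module by a finitely generated ideal form a closed
submodule, provided that it has finite codimension. -/
theorem Ideal.isClosed_smul_top_of_finite_quotient {A : Type*} [CommRing A] [Algebra K A]
    {M : Type*} [NormedAddCommGroup M] [NormedSpace K M] [CompleteSpace M] [Module A M]
    [IsScalarTower K A M] [ContinuousConstSMul A M] {I : Ideal A} (hI : I.FG)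
    [hfin : Module.Finite K (M ⧸ I • (⊤ : Submodule A M))] :
    IsClosed ((I • ⊤ : Submodule A M) : Set M) := by
  obtain ⟨r, x, rfl⟩ := Submodule.fg_iff_exists_fin_generating_family.1 hI
  let v : (Fin r → M) →ₗ[A] M := ∑ i, x i • LinearMap.proj i
  have hv : v.range = Submodule.span A (Set.range x) • (⊤ : Submodule A M) :=
    Ideal.range_sum_smul_proj x
  have hcont : Continuous (v.restrictScalars K) := by
    have : (v : (Fin r → M) → M) = fun m => ∑ i, x i • m i := funext fun m => by
      simp [v, LinearMap.sum_apply]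
    change Continuous v
    rw [this]
    exact continuous_finsetSum _ fun i _ => (continuous_apply i).const_smul (x i)
  let u : (Fin r → M) →L[K] M := ⟨v.restrictScalars K, hcont⟩
  have : Module.Finite K (M ⧸ u.range) := by
    rw [← hv] at hfin
    exact Module.Finite.equiv (Submodule.Quotient.restrictScalarsEquiv K v.range).symm
  have h : IsClosed (u.range : Set M) := u.isClosed_range_of_finite_quotient
  rw [← hv]
  exact h

variable {A : Type*} [NormedCommRing A] [CompleteSpace A] [NormedAlgebra K A]
  {M : Type*} [NormedAddCommGroup M] [NormedSpace K M] [CompleteSpace M] [Module A M]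
  [IsScalarTower K A M] [ContinuousConstSMul A M]

theorem Ideal.isClosed_of_finite_quotient {I : Ideal A} (hI : I.FG) [Module.Finite K (A ⧸ I)] :
    IsClosed (I : Set A) := by
  have h : I • (⊤ : Submodule A A) = I := by rw [smul_eq_mul, Ideal.mul_top]
  have : Module.Finite K (A ⧸ I • (⊤ : Submodule A A)) := by rwa [h]
  have hcl := Ideal.isClosed_smul_top_of_finite_quotient (K := K) (M := A) hI
  rwa [h] at hcl

/-- A twisted derivation maps `I σ⁻¹(I)` into `I M`. -/
theorem mem_smul_top_of_twisted_leibniz {A M : Type*} [CommRing A] [AddCommGroup M] [Module A M]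
    (σ : A →+* A) (D : A →+ M) (hD : ∀ z₁ z₂, D (z₁ * z₂) = z₂ • D z₁ + σ z₁ • D z₂) (I : Ideal A)
    {z : A} (hz : z ∈ I * I.comap σ) : D z ∈ I • (⊤ : Submodule A M) := by
  refine Submodule.mul_induction_on hz (fun a ha b hb => ?_) fun _ _ h h' => ?_
  -- The swap makes `σ` fall on the factor `b ∈ σ⁻¹(I)`, while `a ∈ I` multiplies `D b`.
  · rw [mul_comm, hD]
    exact add_mem (Submodule.smul_mem_smul ha Submodule.mem_top)
      (Submodule.smul_mem_smul hb Submodule.mem_top)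
  · rw [map_add]
    exact add_mem h h'

/-- `A / σ⁻¹(I)` embeds in `A / I`, so `I · σ⁻¹(I)` has finite codimension. It is therefore closed,
and it is killed by the composite. -/
theorem continuous_mkQ_comp_of_twisted_leibniz {M : Type*} [NormedAddCommGroup M] [NormedSpace K M]
    [Module A M] [IsNoetherianRing A] (σ : A →ₐ[K] A) (D : A →ₗ[K] M)
    (hD : ∀ z₁ z₂, D (z₁ * z₂) = z₂ • D z₁ + σ z₁ • D z₂) (I : Ideal A)
    [Module.Finite K (A ⧸ I)] (W : Submodule K M) [IsClosed (W : Set M)]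
    (hW : ∀ m ∈ (I • ⊤ : Submodule A M), m ∈ W) : Continuous (W.mkQ.comp D) := by
  have := Ideal.finite_quotient_comap σ I
  have : Module.Finite K (A ⧸ I * I.comap σ) :=
    Submodule.finite_quotient_smul_of_fg (M := A) (IsNoetherian.noetherian (I.comap σ))
  have hcl : IsClosed ((I * I.comap σ : Ideal A) : Set A) :=
    Ideal.isClosed_of_finite_quotient (K := K) (IsNoetherian.noetherian _)
  have : Module.Finite K (A ⧸ (I * I.comap σ).restrictScalars K) :=
    Module.Finite.equiv (Submodule.Quotient.restrictScalarsEquiv K _).symm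
  refine LinearMap.continuous_of_isClosed_le_ker _ ((I * I.comap σ).restrictScalars K) hcl
    fun z hz => ?_
  rw [LinearMap.mem_ker, LinearMap.comp_apply, Submodule.mkQ_apply, Submodule.Quotient.mk_eq_zero]
  exact hW _ (mem_smul_top_of_twisted_leibniz (σ : A →+* A) D.toAddMonoidHom hD I hz)

theorem IsAffinoidAlgebra.continuous_of_twisted_leibniz [IsUltrametricDist K] [Module.Finite A M]
    (hA : IsAffinoidAlgebra K A) (σ : A →ₐ[K] A) (D : A →ₗ[K] M)
    (hD : ∀ z₁ z₂, D (z₁ * z₂) = z₂ • D z₁ + σ z₁ • D z₂) : Continuous D := by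
  have := hA.isNoetherianRing
  refine D.continuous_of_seq_closed_graph fun u x y hu hDu => ?_
  refine sub_eq_zero.1 (hA.eq_zero_of_forall_mem_pow_smul fun I hI n => ?_)
  have := hA.finite_quotient_of_isMaximal I
  have := Ideal.finite_quotient_pow_smul_top (K := K) (M := M) (J := I) n
  have : Module.Finite K (A ⧸ I ^ n) := by
    have := Ideal.finite_quotient_pow_smul_top (K := K) (M := A) (J := I) n
    rwa [smul_eq_mul, Ideal.mul_top] at this
  obtain ⟨W, hW⟩ : ∃ W : Submodule K M, (W : Set M) = (I ^ n • ⊤ : Submodule A M) :=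
    ⟨(I ^ n • ⊤ : Submodule A M).restrictScalars K, rfl⟩
  have hmem (m : M) : m ∈ W ↔ m ∈ (I ^ n • ⊤ : Submodule A M) := Set.ext_iff.1 hW m
  have : IsClosed (W : Set M) := by
    rw [hW]
    exact Ideal.isClosed_smul_top_of_finite_quotient (K := K) (IsNoetherian.noetherian (I ^ n))
  have hcont := continuous_mkQ_comp_of_twisted_leibniz σ D hD (I ^ n) W fun m => (hmem m).2
  have h1 := (hcont.tendsto x).comp hu
  have h2 := (W.mkQL.continuous.tendsto y).comp hDu
  exact (hmem _).1 ((Submodule.Quotient.eq W).1 (tendsto_nhds_unique h2 h1))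

end Continuity

theorem mainTheorem11
    {K : Type*} [NontriviallyNormedField K] [IsUltrametricDist K] [CompleteSpace K]
    {R : Type*} [CommRing R] [Algebra K R] (hR : IsAffinoidAlgebra K R)
    {A : Type*} [NormedCommRing A] [IsUltrametricDist A] [CompleteSpace A] [NormedAlgebra K A]
    (hA : IsAffinoidAlgebra K A) [Algebra R A] [IsScalarTower K R A]
    (σ : A →ₐ[R] A)
    {M : Type*} [NormedAddCommGroup M] [IsUltrametricDist M] [CompleteSpace M]
    [Module A M] [IsBoundedSMul A M] [Module.Finite A M]
    [Module R M] [IsScalarTower R A M]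
    (D : A →ₗ[R] M) (hD : IsTwistedDerivation σ D) :
    Continuous D := by
  obtain ⟨n, u, hu⟩ := Module.Finite.exists_fin' A M
  have hucont : Continuous u := LinearMap.continuous_on_pi u
  have : IsClosed (u.ker : Set (Fin n → A)) := isClosed_singleton.preimage hucont
  -- `M` is not given as a normed `K`-space, whereas this quotient is a Banach one. Only continuity
  -- of `e` is needed, not of its inverse, since `D = e ∘ D'`.
  let e : ((Fin n → A) ⧸ u.ker) ≃ₗ[A] M := u.quotKerEquivOfSurjective hu
  have hecont : Continuous e := continuous_quot_lift _ hucont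
  let D' : A →ₗ[K] (Fin n → A) ⧸ u.ker :=
    { toFun := fun z => e.symm (D z)
      map_add' := fun z z' => by rw [map_add, map_add]
      map_smul' := fun a z => by
        rw [← algebraMap_smul R a z, map_smul, ← algebraMap_smul A (algebraMap K R a) (D z),
          map_smul, ← IsScalarTower.algebraMap_apply, algebraMap_smul]
        rfl }
  have hD' : Continuous D' :=
    hA.continuous_of_twisted_leibniz (σ.restrictScalars K) D' fun z₁ z₂ => by
      change e.symm (D (z₁ * z₂)) = z₂ • e.symm (D z₁) + σ z₁ • e.symm (D z₂)
      rw [hD z₁ z₂, map_add, map_smul, map_smul]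
  have : (D : A → M) = e ∘ D' := funext fun z => (e.apply_symm_apply (D z)).symm
  rw [this]
  exact hecont.comp hD'
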